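/- Let $\mathbb{R}^n$ carry the Euclidean norm. Let $h:\mathbb{R}^n\to\mathbb{R}$ be differentiable with globally Lipschitz continuous gradient, with Lipschitz constant $L>0$, let $P:\mathbb{R}^n\to(-\infty,\infty]$ be proper, lower semicontinuous and convex, and put $f=h+P$. For a proper function $g:\mathbb{R}^n\to(-\infty,\infty]$ and $x$ with $g(x)<\infty$ let $$\widehat\partial g(x)=\Big\{v:\ \liminf_{z\to x,\,z\ne x}\frac{g(z)-g(x)-\langle v,z-x\rangle}{\|z-x\|}\ge 0\Big\},$$ and let $\partial g(x)$ be the set of all limits $v=\lim_t v^t$ with $v^t\in\widehat\partial g(x^t)$, $x^t\to x$ and $g(x^t)\to g(x)$; both sets are empty if $g(x)=\infty$. A point $x$ is a stationary point of $g$ if $0\in\partial g(x)$. The function $g$ is a KL function with exponent $\frac12$ if for every $\bar x$ with $\partial g(\bar x)\neq\emptyset$ there are $c,\epsilon>0$ and $\nu\in(0,\infty]$ such that $$\operatorname{dist}(0,\partial g(x))\ \ge\ c\,(g(x)-g(\bar x))^{1/2}\quad\text{whenever } \|x-\bar x\|\le\epsilon \text{ and } g(\bar x)<g(x)<g(\bar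 x)+\nu,$$ where the distance to the empty set is $+\infty$. Suppose that $f$ is coercive, i.e. $f(x)\to\infty$ as $\|x\|\to\infty$, and that $f$ is a KL function with exponent $\frac12$. Let $\beta\in[0,1)$ and $\alpha\in\big(0,\frac{2(1-\beta)}{L}\big)$. Let $x^0\in\mathbb{R}^n$ be arbitrary, put $x^{-1}=x^0$, and let $\{x^k\}$ be generated by iPiano with these constant parameters, that is, for all $k\ge 0$, $$x^{k+1}=\operatorname*{arg\,min}_{x\in\mathbb{R}^n}\Big\{\Big\langle\nabla h(x^k)-\frac{\beta}{\alpha}(x^k-x^{k-1}),\,x-x^k\Big\rangle+\frac1{2\alpha}\|x-x^k\|^2+P(x)\Big\}.$$ Then there is a stationary point $\bar x$ of $f$ such that $x^k\to\bar x$ and $\{x^k\}$ converges to $\bar x$ $R$-linearly, i.e. $\limsup_{k\to\infty}\|x^k-\bar x\|^{1/k}<1$. -/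

import Mathlib

open Filter Topology Set
open scoped Gradient

/-- Extended-real-valued `f` is proper: it never takes the value `-∞` and its domain
`{x | f x < ∞}` is nonempty. -/
def ProperFun {n : ℕ} (f : EuclideanSpace ℝ (Fin n) → EReal) : Prop :=
  (∀ x, f x ≠ ⊥) ∧ ∃ x, f x < ⊤

/-- Convexity of an extended-real-valued function: its epigraph is a convex set. -/
def ConvexFun {n : ℕ} (f : EuclideanSpace ℝ (Fin n) → EReal) : Prop :=
  Convex ℝ {p : EuclideanSpace ℝ (Fin n) × ℝ | f p.1 ≤ (p.2 : EReal)}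

/-- Coercivity: `f x → ∞` as `‖x‖ → ∞`. -/
def CoerciveFun {n : ℕ} (f : EuclideanSpace ℝ (Fin n) → EReal) : Prop :=
  Tendsto f (Bornology.cobounded (EuclideanSpace ℝ (Fin n))) (𝓝 ⊤)

/-- The regular subdifferential of a proper function `f` at `x`; it is empty outside `dom f`. -/
noncomputable def regularSubdifferential {n : ℕ} (f : EuclideanSpace ℝ (Fin n) → EReal)
    (x : EuclideanSpace ℝ (Fin n)) : Set (EuclideanSpace ℝ (Fin n)) :=
  {v | f x < ⊤ ∧
    0 ≤ liminf (fun z => (f z - f x - ((inner ℝ v (z - x) : ℝ) : EReal)) / ((‖z - x‖ : ℝ) : EReal))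
      (𝓝[≠] x)}

/-- The limiting subdifferential of a proper function `f` at `x`; it is empty outside `dom f`. -/
noncomputable def limitingSubdifferential {n : ℕ} (f : EuclideanSpace ℝ (Fin n) → EReal)
    (x : EuclideanSpace ℝ (Fin n)) : Set (EuclideanSpace ℝ (Fin n)) :=
  {v | f x < ⊤ ∧ ∃ (y w : ℕ → EuclideanSpace ℝ (Fin n)),
    Tendsto y atTop (𝓝 x) ∧ Tendsto (fun t => f (y t)) atTop (𝓝 (f x)) ∧
    Tendsto w atTop (𝓝 v) ∧ ∀ t, w t ∈ regularSubdifferential f (y t)}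

/-- `x` is a stationary point of `f`. -/
def IsStationaryPoint {n : ℕ} (f : EuclideanSpace ℝ (Fin n) → EReal)
    (x : EuclideanSpace ℝ (Fin n)) : Prop :=
  0 ∈ limitingSubdifferential f x

/-- `f` has the KL property at `a` with exponent `θ`. The distance to the empty set is `∞`
(the value of `Metric.infEDist`), and in the conclusion `f x` and `f a` are finite, so that
`EReal.toReal` is the honest value of their difference. -/
def HasKLExponentAt {n : ℕ} (f : EuclideanSpace ℝ (Fin n) → EReal) (θ : ℝ)
    (a : EuclideanSpace ℝ (Fin n)) : Prop :=
  ∃ c > (0 : ℝ), ∃ ε > (0 : ℝ), ∃ ν > (0 : EReal), ∀ x,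
    ‖x - a‖ ≤ ε → f a < f x → f x < f a + ν →
      ENNReal.ofReal (c * (f x - f a).toReal ^ θ) ≤
        Metric.infEDist 0 (limitingSubdifferential f x)

/-- `f` is a KL function with exponent `θ`: it has the KL property with exponent `θ` at every
point where the limiting subdifferential is nonempty. -/
def IsKLFunctionWithExponent {n : ℕ} (f : EuclideanSpace ℝ (Fin n) → EReal) (θ : ℝ) : Prop :=
  ∀ a, (limitingSubdifferential f a).Nonempty → HasKLExponentAt f θ a

/-- The objective of the iPiano subproblem with step-size `α` and inertial parameter `β`, where
`cur` is the current and `prev` the previous iterate. -/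
noncomputable def iPianoObjective {n : ℕ} (h : EuclideanSpace ℝ (Fin n) → ℝ)
    (P : EuclideanSpace ℝ (Fin n) → EReal) (α β : ℝ) (prev cur : EuclideanSpace ℝ (Fin n))
    (y : EuclideanSpace ℝ (Fin n)) : EReal :=
  ((inner ℝ (∇ h cur - (β / α) • (cur - prev)) (y - cur) + 1 / (2 * α) * ‖y - cur‖ ^ 2 : ℝ) : EReal)
    + P y

/-- `x⁰, x¹, …` is generated by iPiano with constant step-size `α` and inertial parameter `β`.
The initial step uses `x⁻¹ = x⁰`; the point `x⁰` is arbitrary. -/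
def IsIPianoSequence {n : ℕ} (h : EuclideanSpace ℝ (Fin n) → ℝ)
    (P : EuclideanSpace ℝ (Fin n) → EReal) (α β : ℝ) (x : ℕ → EuclideanSpace ℝ (Fin n)) : Prop :=
  IsMinOn (iPianoObjective h P α β (x 0) (x 0)) univ (x 1) ∧
    ∀ k, IsMinOn (iPianoObjective h P α β (x k) (x (k + 1))) univ (x (k + 2))

/-- `x` converges R-linearly to `a`: `x k → a` and `limsup ‖x k - a‖ ^ (1 / k) < 1`. -/
def ConvergesRLinearly {n : ℕ} (x : ℕ → EuclideanSpace ℝ (Fin n))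
    (a : EuclideanSpace ℝ (Fin n)) : Prop :=
  Tendsto x atTop (𝓝 a) ∧
    limsup (fun k : ℕ => ((‖x k - a‖ ^ (1 / (k : ℝ)) : ℝ) : EReal)) atTop < 1

/-!
An iPiano step minimizes a convex function, so Fermat's rule exhibits a subgradient of `P` at the
new iterate. Its subgradient inequality combined with the descent lemma for `h` shows that the
objective plus a multiple of the squared length of the last step, the Lyapunov function, decreases
by at least a multiple of the sum `D` of the squared lengths of the last two steps; hence it
converges, to some `s`, and `D → 0`. The same subgradient plus `∇ h` is an element of the
subdifferential of `f = h + P` with squared norm `O(D)`. Every cluster point of the iterates is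
therefore stationary with `f`-value `s`, and the Kurdyka–Łojasiewicz inequality with exponent
`1 / 2` near the compact set of cluster points gives `f - s = O(D)`. So the Lyapunov gap is at most
a multiple of its own decrease, which makes it contract geometrically; the step lengths are bounded
by a multiple of its square root.
-/

section GeometricConvergence

lemma limsup_rpow_one_div_lt_one_of_isBigO_pow {u : ℕ → ℝ} {r : ℝ} (hu : ∀ k, 0 ≤ u k)
    (hr0 : 0 ≤ r) (hr1 : r < 1) (h : u =O[atTop] fun k => r ^ k) :
    limsup (fun k : ℕ => ((u k ^ (1 / (k : ℝ)) : ℝ) : EReal)) atTop < 1 := by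
  obtain ⟨C, hC, hbound⟩ := h.exists_pos
  have hlim : Tendsto (fun k : ℕ => C ^ (1 / (k : ℝ)) * r) atTop (𝓝 r) := by
    have hroot := ((Real.continuous_const_rpow hC.ne').tendsto 0).comp
      tendsto_one_div_atTop_nhds_zero_nat
    simpa using hroot.mul_const r
  obtain ⟨s, hrs, hs1⟩ := exists_between hr1
  have hev : ∀ᶠ k : ℕ in atTop, ((u k ^ (1 / (k : ℝ)) : ℝ) : EReal) ≤ (s : EReal) := by
    filter_upwards [hbound.bound, hlim.eventually_lt_const hrs, eventually_ne_atTop 0]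
      with k hk hks hk0
    rw [Real.norm_of_nonneg (hu k), Real.norm_of_nonneg (pow_nonneg hr0 k)] at hk
    refine EReal.coe_le_coe (le_trans ?_ hks.le)
    calc u k ^ (1 / (k : ℝ)) ≤ (C * r ^ k) ^ (1 / (k : ℝ)) :=
          Real.rpow_le_rpow (hu k) hk (by positivity)
      _ = C ^ (1 / (k : ℝ)) * r := by
          rw [Real.mul_rpow hC.le (pow_nonneg hr0 k), one_div, Real.pow_rpow_inv_natCast hr0 hk0]
  exact (limsup_le_of_le (by isBoundedDefault) hev).trans_lt (by exact_mod_cast hs1)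

lemma isBigO_pow_of_eventually_succ_le_mul {e : ℕ → ℝ} {q : ℝ} (hq : 0 < q) (he : ∀ k, 0 ≤ e k)
    (h : ∀ᶠ k in atTop, e (k + 1) ≤ q * e k) : e =O[atTop] fun k => q ^ k := by
  obtain ⟨N, hN⟩ := eventually_atTop.1 h
  refine Asymptotics.IsBigO.of_bound (e N / q ^ N) ?_
  filter_upwards [eventually_ge_atTop N] with k hk
  obtain ⟨j, rfl⟩ := Nat.exists_eq_add_of_le hk
  have hgeom := le_geom (u := fun i => e (N + i)) hq.le j fun i _ => hN (N + i) (by omega)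
  rw [Real.norm_of_nonneg (he _), Real.norm_of_nonneg (by positivity), pow_add, ← mul_assoc,
    div_mul_cancel₀ _ (by positivity), mul_comm]
  exact hgeom

variable {X : Type*} [PseudoMetricSpace X] [CompleteSpace X]

lemma exists_tendsto_isBigO_dist_of_isBigO_pow {y : ℕ → X} {r : ℝ} (hr0 : 0 < r) (hr1 : r < 1)
    (h : (fun k => dist (y k) (y (k + 1))) =O[atTop] fun k => r ^ k) :
    ∃ a, Tendsto y atTop (𝓝 a) ∧ (fun k => dist (y k) a) =O[atTop] fun k => r ^ k := by
  obtain ⟨C, -, hC⟩ := Asymptotics.bound_of_isBigO_nat_atTop h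
  have hdist : ∀ k, dist (y k) (y (k + 1)) ≤ C * r ^ k := fun k => by
    simpa [abs_of_pos hr0] using hC (pow_ne_zero k hr0.ne')
  obtain ⟨a, ha⟩ := cauchySeq_tendsto_of_complete (cauchySeq_of_le_geometric r C hr1 hdist)
  refine ⟨a, ha, Asymptotics.IsBigO.of_bound (C / (1 - r)) (Eventually.of_forall fun k => ?_)⟩
  rw [Real.norm_of_nonneg dist_nonneg, Real.norm_of_nonneg (by positivity), div_mul_eq_mul_div]
  exact dist_le_of_le_geometric_of_tendsto r C hr1 hdist ha k

lemma exists_tendsto_isBigO_dist_of_sq_dist_le {y : ℕ → X} {e : ℕ → ℝ} {κ q : ℝ} (hκ : 0 < κ)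
    (hq0 : 0 < q) (hq1 : q < 1) (he : ∀ k, 0 ≤ e k)
    (hdec : ∀ k, κ * dist (y k) (y (k + 1)) ^ 2 ≤ e k - e (k + 1))
    (hlin : ∀ᶠ k in atTop, e (k + 1) ≤ q * e k) :
    ∃ a, Tendsto y atTop (𝓝 a) ∧ (fun k => dist (y k) a) =O[atTop] fun k => √q ^ k := by
  refine exists_tendsto_isBigO_dist_of_isBigO_pow (Real.sqrt_pos.2 hq0)
    ((Real.sqrt_lt' one_pos).2 (by simpa using hq1)) (Asymptotics.IsBigO.of_pow two_ne_zero ?_)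
  have hsq : ((fun k => dist (y k) (y (k + 1))) ^ 2) =O[atTop] e := by
    refine Asymptotics.IsBigO.of_bound κ⁻¹ (Eventually.of_forall fun k => ?_)
    rw [Pi.pow_apply, Real.norm_of_nonneg (sq_nonneg _), Real.norm_of_nonneg (he k),
      le_inv_mul_iff₀ hκ]
    linarith [hdec k, he (k + 1)]
  refine (hsq.trans (isBigO_pow_of_eventually_succ_le_mul hq0 he hlin)).congr_right fun k => ?_
  rw [Pi.pow_apply, ← pow_mul, mul_comm, pow_mul, Real.sq_sqrt hq0.le]

lemma exists_tendsto_of_sufficient_decrease {H D : ℕ → ℝ} {κ : ℝ} (hκ : 0 < κ)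
    (hD : ∀ k, 0 ≤ D k) (hdec : ∀ k, κ * D k ≤ H k - H (k + 1)) (hH : BddBelow (range H)) :
    ∃ s, Tendsto H atTop (𝓝 s) ∧ (∀ k, s ≤ H k) ∧ Tendsto D atTop (𝓝 0) := by
  have hanti : Antitone H := antitone_nat_of_succ_le fun k => by
    linarith [hdec k, mul_nonneg hκ.le (hD k)]
  have hlim := tendsto_atTop_ciInf hanti hH
  refine ⟨⨅ k, H k, hlim, ciInf_le hH, squeeze_zero hD (fun k => ?_)
    (g := fun k => κ⁻¹ * (H k - H (k + 1))) ?_⟩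
  · exact (le_inv_mul_iff₀ hκ).2 (hdec k)
  · simpa using (hlim.sub ((tendsto_add_atTop_iff_nat 1).2 hlim)).const_mul κ⁻¹

lemma exists_eventually_succ_sub_le_mul_of_sufficient_decrease {H D : ℕ → ℝ} {κ M s : ℝ}
    (hκ : 0 < κ) (hM : 0 < M) (hdec : ∀ k, κ * D k ≤ H k - H (k + 1))
    (herr : ∀ᶠ k in atTop, H (k + 1) - s ≤ M * D k) :
    ∃ q, 0 < q ∧ q < 1 ∧ ∀ᶠ k in atTop, H (k + 1) - s ≤ q * (H k - s) := by
  refine ⟨M / (κ + M), by positivity, (div_lt_one (by positivity)).2 (by linarith), ?_⟩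
  filter_upwards [herr] with k hk
  rw [div_mul_eq_mul_div, le_div_iff₀ (by positivity)]
  linarith [mul_le_mul_of_nonneg_left hk hκ.le, mul_le_mul_of_nonneg_left (hdec k) hM.le]

end GeometricConvergence

lemma tendsto_zero_of_tendsto_sq_norm_add_sq_norm {ι E : Type*} [SeminormedAddCommGroup E]
    {l : Filter ι} {u v : ι → E} (h : Tendsto (fun i => ‖u i‖ ^ 2 + ‖v i‖ ^ 2) l (𝓝 0)) :
    Tendsto u l (𝓝 0) ∧ Tendsto v l (𝓝 0) := by
  have hzero : ∀ w : ι → E, (∀ i, ‖w i‖ ^ 2 ≤ ‖u i‖ ^ 2 + ‖v i‖ ^ 2) → Tendsto w l (𝓝 0) :=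
    fun w hw => squeeze_zero_norm (fun i => Real.le_sqrt_of_sq_le (hw i)) (by simpa using h.sqrt)
  exact ⟨hzero u fun i => le_add_of_nonneg_right (sq_nonneg _),
    hzero v fun i => le_add_of_nonneg_left (sq_nonneg _)⟩

lemma exists_eventually_le_mul_of_mapClusterPt {ι X : Type*} [TopologicalSpace X] {K : Set X}
    (hK : IsCompact K) {l : Filter ι} {y : ι → X} {u w : ι → ℝ} (hyK : ∀ᶠ i in l, y i ∈ K)
    (hw : ∀ i, 0 ≤ w i)
    (hloc : ∀ a, MapClusterPt a l y → ∃ M, ∀ᶠ i in comap y (𝓝 a) ⊓ l, u i ≤ M * w i) :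
    ∃ M ≥ 0, ∀ᶠ i in l, u i ≤ M * w i := by
  suffices ∃ M ≥ 0, ∀ᶠ i in l, y i ∈ K → u i ≤ M * w i by
    obtain ⟨M, hM, h⟩ := this
    exact ⟨M, hM, h.mp (hyK.mono fun _ hi h => h hi)⟩
  refine hK.induction_on (p := fun S => ∃ M ≥ 0, ∀ᶠ i in l, y i ∈ S → u i ≤ M * w i)
    ⟨0, le_rfl, by simp⟩ ?mono ?union ?nhds
  case mono =>
    rintro S T hST ⟨M, hM, hT⟩
    exact ⟨M, hM, hT.mono fun i hi hy => hi (hST hy)⟩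
  case union =>
    rintro S T ⟨M, hM, hS⟩ ⟨N, -, hT⟩
    refine ⟨max M N, hM.trans (le_max_left M N), ?_⟩
    filter_upwards [hS, hT] with i hiS hiT
    rintro (hy | hy)
    · exact (hiS hy).trans (mul_le_mul_of_nonneg_right (le_max_left M N) (hw i))
    · exact (hiT hy).trans (mul_le_mul_of_nonneg_right (le_max_right M N) (hw i))
  case nhds =>
    intro a _
    obtain ⟨M, hM⟩ : ∃ M, ∀ᶠ i in comap y (𝓝 a) ⊓ l, u i ≤ M * w i := by
      by_cases ha : MapClusterPt a l y
      · exact hloc a ha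
      · rw [MapClusterPt, ClusterPt, ← neBot_inf_comap_iff_map', not_neBot] at ha
        exact ⟨0, by simp [ha]⟩
    obtain ⟨S, ⟨U, hU, hUS⟩, T, hT, hST⟩ := eventually_inf.1 hM
    refine ⟨U, mem_nhdsWithin_of_mem_nhds hU, max M 0, le_max_right M 0, ?_⟩
    filter_upwards [hT] with i hiT hiU
    exact (hST i ⟨hUS hiU, hiT⟩).trans (mul_le_mul_of_nonneg_right (le_max_left M 0) (hw i))

section Subgradient

variable {E : Type*} [NormedAddCommGroup E] [InnerProductSpace ℝ E]

/-- `w` is a subgradient of the extended-real-valued function `P` at `y` in the sense of convex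
analysis: the affine function with slope `w` through `(y, P y)` lies below `P`. -/
def HasSubgradientAt (P : E → EReal) (w y : E) : Prop :=
  ∀ z, P y + ((inner ℝ w (z - y) : ℝ) : EReal) ≤ P z

lemma HasSubgradientAt.add_inner_le {P : E → EReal} {w y z : E} {p q : ℝ}
    (hw : HasSubgradientAt P w y) (hy : P y = p) (hz : P z = q) :
    p + inner ℝ w (z - y) ≤ q := by
  have := hw z
  rwa [hy, hz, ← EReal.coe_add, EReal.coe_le_coe_iff] at this

/-- The subgradient inequality bounds `P a` below by `s`, lower semicontinuity bounds it above. -/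
lemma HasSubgradientAt.of_tendsto {ι : Type*} {l : Filter ι} [NeBot l] {P : E → EReal}
    (hP : LowerSemicontinuous P) {y w : ι → E} {p : ι → ℝ} {a v : E} {s : ℝ}
    (hp : ∀ i, P (y i) = p i) (hw : ∀ i, HasSubgradientAt P (w i) (y i))
    (hy : Tendsto y l (𝓝 a)) (hwv : Tendsto w l (𝓝 v)) (hps : Tendsto p l (𝓝 s)) :
    P a = s ∧ HasSubgradientAt P v a := by
  have hminorant : ∀ z, ((s + inner ℝ v (z - a) : ℝ) : EReal) ≤ P z := by
    intro z
    have hlim : Tendsto (fun i => ((p i + inner ℝ (w i) (z - y i) : ℝ) : EReal)) l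
        (𝓝 ((s + inner ℝ v (z - a) : ℝ) : EReal)) :=
      (continuous_coe_real_ereal.tendsto _).comp
        (hps.add (hwv.inner (tendsto_const_nhds.sub hy)))
    refine le_of_tendsto' hlim fun i => ?_
    rw [EReal.coe_add, ← hp i]
    exact hw i z
  have hPa : P a ≤ s := by
    have hlim : Tendsto (fun i => P (y i)) l (𝓝 (s : EReal)) := by
      simpa only [hp] using EReal.tendsto_coe.2 hps
    refine le_of_forall_lt_imp_le_of_dense fun c hc => ?_
    exact ge_of_tendsto hlim ((hy.eventually (hP a c hc)).mono fun _ => le_of_lt)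
  have hval : P a = s := le_antisymm hPa (by simpa using hminorant a)
  exact ⟨hval, fun z => by rw [hval, ← EReal.coe_add]; exact hminorant z⟩

lemma HasSubgradientAt.exists_le_add_of_isBounded [ProperSpace E] {P : E → EReal} {w y : E}
    {p : ℝ} (hw : HasSubgradientAt P w y) (hy : P y = p) {h : E → ℝ} (hh : Continuous h)
    {S : Set E} (hS : Bornology.IsBounded S) :
    ∃ m : ℝ, ∀ z ∈ S, (m : EReal) ≤ h z + P z := by
  have hcont : Continuous fun z => h z + (p + inner ℝ w (z - y)) := by fun_prop
  obtain ⟨m, hm⟩ := hS.isCompact_closure.bddBelow_image hcont.continuousOn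
  refine ⟨m, fun z hz => ?_⟩
  calc (m : EReal) ≤ ((h z + (p + inner ℝ w (z - y)) : ℝ) : EReal) :=
        EReal.coe_le_coe (hm (mem_image_of_mem _ (subset_closure hz)))
    _ = h z + (P y + ((inner ℝ w (z - y) : ℝ) : EReal)) := by
        rw [hy, EReal.coe_add, EReal.coe_add]
    _ ≤ h z + P z := by gcongr; exact hw z

variable [CompleteSpace E]

/-- Fermat's rule. On the convex epigraph of `P`, the function `(z, r) ↦ g z + r` is smooth and has
a local minimum at `(y, P y)`. -/
lemma hasSubgradientAt_neg_gradient_of_isLocalMin_add {P : E → EReal} {g : E → ℝ} {g' y : E}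
    {p : ℝ} (hconv : Convex ℝ {z : E × ℝ | P z.1 ≤ (z.2 : EReal)}) (hy : P y = p)
    (hg : HasGradientAt g g' y) (hmin : IsLocalMin (fun z => (g z : EReal) + P z) y) :
    HasSubgradientAt P (-g') y := by
  intro z
  refine EReal.le_of_forall_lt_iff_le.1 fun q hq => ?_
  set S := {z : E × ℝ | P z.1 ≤ (z.2 : EReal)}
  have hminS : IsLocalMinOn (fun z : E × ℝ => g z.1 + z.2) S (y, p) := by
    have hfst : ∀ᶠ z in 𝓝[S] (y, p), (g y : EReal) + P y ≤ g z.1 + P z.1 :=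
      nhdsWithin_le_nhds ((continuous_fst.tendsto (y, p)).eventually hmin)
    filter_upwards [hfst, self_mem_nhdsWithin] with z hz hzS
    have hle := hz.trans (add_le_add_right hzS (g z.1 : EReal))
    rw [hy] at hle
    exact_mod_cast hle
  have hderiv : HasFDerivWithinAt (fun z : E × ℝ => g z.1 + z.2) _ S (y, p) :=
    ((hg.hasFDerivAt.comp (y, p) hasFDerivAt_fst).add hasFDerivAt_snd).hasFDerivWithinAt
  have hdir : (z, q) - (y, p) ∈ posTangentConeAt S (y, p) :=
    sub_mem_posTangentConeAt_of_segment_subset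
      (hconv.segment_subset (show P y ≤ p from hy.le) (show P z ≤ q from hq.le))
  have hnonneg : 0 ≤ inner ℝ g' (z - y) + (q - p) := by
    simpa using hminS.hasFDerivWithinAt_nonneg hderiv hdir
  rw [hy, ← EReal.coe_add, EReal.coe_le_coe_iff, inner_neg_left]
  linarith

lemma hasGradientAt_inner_add_sq_norm (v c y : E) (α : ℝ) :
    HasGradientAt (fun z => inner ℝ v (z - c) + 1 / (2 * α) * ‖z - c‖ ^ 2)
      (v + (1 / α) • (y - c)) y := by
  have hsub : HasFDerivAt (fun z : E => z - c) (ContinuousLinearMap.id ℝ E) y :=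
    (hasFDerivAt_id y).sub_const c
  have hinner := (hasFDerivAt_const v y).inner ℝ hsub
  refine (hinner.add (hsub.norm_sq.const_mul (1 / (2 * α)))).congr_fderiv ?_
  ext z
  simp only [ContinuousLinearMap.comp_id, add_apply, ContinuousLinearMap.comp_apply,
    ContinuousLinearMap.prod_apply, zero_apply, ContinuousLinearMap.id_apply, fderivInnerCLM_apply,
    inner_zero_left, add_zero, smul_apply, coe_innerSL_apply, nsmul_eq_mul, Nat.cast_ofNat,
    smul_eq_mul, map_add, map_smul, InnerProductSpace.toDual_apply_apply]
  ring

lemma le_add_inner_gradient_add_sq_norm_of_lipschitz {h : E → ℝ} {L : ℝ}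
    (hdiff : Differentiable ℝ h) (hLip : ∀ x y, ‖∇ h x - ∇ h y‖ ≤ L * ‖x - y‖) (x z : E) :
    h z ≤ h x + inner ℝ (∇ h x) (z - x) + L / 2 * ‖z - x‖ ^ 2 := by
  set d := z - x with hd
  let φ : ℝ → ℝ := fun t => h (x + t • d) - t * inner ℝ (∇ h x) d - L / 2 * t ^ 2 * ‖d‖ ^ 2
  have hφ : ∀ t, HasDerivAt φ (inner ℝ (∇ h (x + t • d) - ∇ h x) d - L * t * ‖d‖ ^ 2) t := by
    intro t
    have hline : HasDerivAt (fun t : ℝ => x + t • d) d t := by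
      simpa using ((hasDerivAt_id t).smul_const d).const_add x
    have hcomp := (hdiff (x + t • d)).hasGradientAt.hasFDerivAt.comp_hasDerivAt t hline
    refine ((hcomp.sub ((hasDerivAt_id t).mul_const (inner ℝ (∇ h x) d))).sub
      ((((hasDerivAt_id t).pow 2).const_mul (L / 2)).mul_const (‖d‖ ^ 2))).congr_deriv ?_
    simp only [InnerProductSpace.toDual_apply_apply, id_eq, Nat.cast_ofNat, inner_sub_left]
    ring
  have hanti : AntitoneOn φ (Icc 0 1) := by
    refine antitoneOn_of_deriv_nonpos (convex_Icc 0 1)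
      (fun t _ => (hφ t).continuousAt.continuousWithinAt)
      (fun t _ => (hφ t).differentiableAt.differentiableWithinAt) fun t ht => ?_
    rw [interior_Icc] at ht
    rw [(hφ t).deriv, sub_nonpos]
    calc inner ℝ (∇ h (x + t • d) - ∇ h x) d ≤ ‖∇ h (x + t • d) - ∇ h x‖ * ‖d‖ :=
          real_inner_le_norm _ _
      _ ≤ L * ‖x + t • d - x‖ * ‖d‖ := by gcongr; exact hLip _ _
      _ = L * t * ‖d‖ ^ 2 := by
          rw [add_sub_cancel_left, norm_smul, Real.norm_of_nonneg ht.1.le]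
          ring
  have hφ01 : φ 1 ≤ φ 0 :=
    hanti (left_mem_Icc.2 zero_le_one) (right_mem_Icc.2 zero_le_one) zero_le_one
  have hφ0 : φ 0 = h x := by simp [φ]
  have hφ1 : φ 1 = h z - inner ℝ (∇ h x) d - L / 2 * ‖d‖ ^ 2 := by simp [φ, hd]
  linarith

end Subgradient

section LimitingSubdifferential

variable {n : ℕ}

lemma HasSubgradientAt.add_gradient_mem_regularSubdifferential
    {h : EuclideanSpace ℝ (Fin n) → ℝ} {P : EuclideanSpace ℝ (Fin n) → EReal}
    {y w g : EuclideanSpace ℝ (Fin n)} {p : ℝ} (hw : HasSubgradientAt P w y) (hy : P y = p)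
    (hh : HasGradientAt h g y) :
    g + w ∈ regularSubdifferential (fun x => (h x : EReal) + P x) y := by
  refine ⟨EReal.add_lt_top (EReal.coe_ne_top _) (hy ▸ EReal.coe_ne_top _), ?_⟩
  refine EReal.ge_of_forall_gt_iff_ge.1 fun c hc => le_liminf_of_le (by isBoundedDefault) ?_
  have hc' : c < 0 := by exact_mod_cast hc
  filter_upwards [nhdsWithin_le_nhds ((hasGradientAt_iff_isLittleO.1 hh).def (neg_pos.2 hc')),
    self_mem_nhdsWithin] with z hz hne
  have hpos : 0 < ‖z - y‖ := norm_pos_iff.2 (sub_ne_zero.2 hne)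
  have hlin : c * ‖z - y‖ + inner ℝ g (z - y) ≤ h z - h y := by
    linarith [neg_le_of_abs_le hz]
  rw [EReal.le_div_iff_mul_le (by exact_mod_cast hpos) (EReal.coe_ne_top _)]
  induction hq : P z using EReal.rec with
  | bot => simpa [hq, hy, ← EReal.coe_add] using hw z
  | top =>
    rw [hy, EReal.coe_add_top, ← EReal.coe_add, EReal.top_sub_coe, EReal.top_sub_coe]
    exact le_top
  | coe q =>
    rw [hy, ← EReal.coe_add, ← EReal.coe_add, ← EReal.coe_sub, ← EReal.coe_sub,
      ← EReal.coe_mul, EReal.coe_le_coe_iff, inner_add_left]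
    linarith [hw.add_inner_le hy hq]

lemma regularSubdifferential_subset_limitingSubdifferential
    (f : EuclideanSpace ℝ (Fin n) → EReal) (x : EuclideanSpace ℝ (Fin n)) :
    regularSubdifferential f x ⊆ limitingSubdifferential f x := fun v hv =>
  ⟨hv.1, fun _ => x, fun _ => v, tendsto_const_nhds, tendsto_const_nhds, tendsto_const_nhds,
    fun _ => hv⟩

lemma HasSubgradientAt.add_gradient_mem_limitingSubdifferential
    {h : EuclideanSpace ℝ (Fin n) → ℝ} {P : EuclideanSpace ℝ (Fin n) → EReal}
    {y w g : EuclideanSpace ℝ (Fin n)} {p : ℝ} (hw : HasSubgradientAt P w y) (hy : P y = p)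
    (hh : HasGradientAt h g y) :
    g + w ∈ limitingSubdifferential (fun x => (h x : EReal) + P x) y :=
  regularSubdifferential_subset_limitingSubdifferential _ _
    (hw.add_gradient_mem_regularSubdifferential hy hh)

lemma CoerciveFun.isBounded_sublevel {f : EuclideanSpace ℝ (Fin n) → EReal} (hf : CoerciveFun f)
    (c : ℝ) : Bornology.IsBounded {x | f x ≤ c} := by
  rw [Bornology.isBounded_def]
  filter_upwards [EReal.tendsto_nhds_top_iff_real.1 hf c] with x hx using not_le.2 hx

lemma HasKLExponentAt.exists_eventually_mul_rpow_le_norm {f : EuclideanSpace ℝ (Fin n) → EReal}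
    {θ s : ℝ} {a : EuclideanSpace ℝ (Fin n)} (hf : HasKLExponentAt f θ a) (ha : f a = s)
    {ι : Type*} {l : Filter ι} {y v : ι → EuclideanSpace ℝ (Fin n)} {q : ι → ℝ}
    (hy : Tendsto y l (𝓝 a)) (hq : Tendsto q l (𝓝 s)) (hfy : ∀ i, f (y i) = q i)
    (hv : ∀ i, v i ∈ limitingSubdifferential f (y i)) :
    ∃ c > 0, ∀ᶠ i in l, s < q i → c * (q i - s) ^ θ ≤ ‖v i‖ := by
  obtain ⟨c, hc, ε, hε, ν, hν, hKL⟩ := hf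
  have hsν : f a < f a + ν := by
    rw [ha]
    simpa using EReal.add_lt_add_left_coe hν s
  have hval : Tendsto (fun i => f (y i)) l (𝓝 (f a)) := by
    simpa only [hfy, ha] using EReal.tendsto_coe.2 hq
  refine ⟨c, hc, ?_⟩
  filter_upwards [hy.eventually (Metric.closedBall_mem_nhds a hε), hval.eventually_lt_const hsν]
    with i hball hlt hsq
  have hdist := (hKL (y i) (by rwa [← dist_eq_norm])
    (by rw [ha, hfy]; exact_mod_cast hsq) hlt).trans (Metric.infEDist_le_edist_of_mem (hv i))
  rwa [edist_dist, dist_zero_left, ENNReal.ofReal_le_ofReal_iff (norm_nonneg _), ha, hfy,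
    ← EReal.coe_sub, EReal.toReal_coe] at hdist

lemma HasKLExponentAt.exists_eventually_sub_le_mul_sq_norm
    {f : EuclideanSpace ℝ (Fin n) → EReal} {s : ℝ} {a : EuclideanSpace ℝ (Fin n)}
    (hf : HasKLExponentAt f (1 / 2) a) (ha : f a = s)
    {ι : Type*} {l : Filter ι} {y v : ι → EuclideanSpace ℝ (Fin n)} {q : ι → ℝ}
    (hy : Tendsto y l (𝓝 a)) (hq : Tendsto q l (𝓝 s)) (hfy : ∀ i, f (y i) = q i)
    (hv : ∀ i, v i ∈ limitingSubdifferential f (y i)) :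
    ∃ M, ∀ᶠ i in l, q i - s ≤ M * ‖v i‖ ^ 2 := by
  obtain ⟨c, hc, hKL⟩ := hf.exists_eventually_mul_rpow_le_norm ha hy hq hfy hv
  refine ⟨(c ^ 2)⁻¹, hKL.mono fun i hi => ?_⟩
  rcases le_or_gt (q i) s with hqs | hqs
  · exact (sub_nonpos.2 hqs).trans (by positivity)
  · have hsqrt : c * √(q i - s) ≤ ‖v i‖ := by simpa only [Real.sqrt_eq_rpow] using hi hqs
    rw [le_inv_mul_iff₀ (by positivity)]
    calc c ^ 2 * (q i - s) = (c * √(q i - s)) ^ 2 := by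
          rw [mul_pow, Real.sq_sqrt (sub_pos.2 hqs).le]
      _ ≤ ‖v i‖ ^ 2 := by gcongr

/-- Compactness makes the constant in the Kurdyka–Łojasiewicz inequality uniform over all cluster
points. -/
lemma exists_eventually_sub_le_mul_sq_norm_of_hasKLExponentAt
    {f : EuclideanSpace ℝ (Fin n) → EReal} {s : ℝ}
    {ι : Type*} {l : Filter ι} {y v : ι → EuclideanSpace ℝ (Fin n)} {q : ι → ℝ}
    (hbdd : Bornology.IsBounded (range y)) (hq : Tendsto q l (𝓝 s)) (hfy : ∀ i, f (y i) = q i)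
    (hv : ∀ i, v i ∈ limitingSubdifferential f (y i))
    (hcluster : ∀ a, MapClusterPt a l y → f a = s ∧ HasKLExponentAt f (1 / 2) a) :
    ∃ M ≥ 0, ∀ᶠ i in l, q i - s ≤ M * ‖v i‖ ^ 2 :=
  exists_eventually_le_mul_of_mapClusterPt hbdd.isCompact_closure
    (Eventually.of_forall fun i => subset_closure (mem_range_self i)) (fun _ => sq_nonneg _)
    fun a ha => (hcluster a ha).2.exists_eventually_sub_le_mul_sq_norm (hcluster a ha).1
      (tendsto_comap.mono_left inf_le_left) (hq.mono_left inf_le_right) hfy hv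

lemma convergesRLinearly_of_isBigO_pow {x : ℕ → EuclideanSpace ℝ (Fin n)}
    {a : EuclideanSpace ℝ (Fin n)} {r : ℝ} (hr0 : 0 ≤ r) (hr1 : r < 1)
    (hrate : (fun k => dist (x k) a) =O[atTop] fun k => r ^ k) : ConvergesRLinearly x a :=
  ⟨tendsto_iff_dist_tendsto_zero.2
      (hrate.trans_tendsto (tendsto_pow_atTop_nhds_zero_of_lt_one hr0 hr1)),
    limsup_rpow_one_div_lt_one_of_isBigO_pow (fun _ => norm_nonneg _) hr0 hr1
      (by simpa only [dist_eq_norm] using hrate)⟩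

end LimitingSubdifferential

section IPianoStep

variable {E : Type*} [NormedAddCommGroup E]

/-- The Lyapunov function of iPiano: the objective plus a multiple of the squared length of the last
step. The weight is the one for which an iPiano step decreases this function by the same multiple
`iPianoDecrease` of the squared lengths of the last two steps. Meaningful only if `P cur` is finite,
because of `EReal.toReal`. -/
noncomputable def iPianoLyapunov (h : E → ℝ) (P : E → EReal) (L α : ℝ) (prev cur : E) : ℝ :=
  h cur + (P cur).toReal + (1 / (2 * α) - L / 4) * ‖cur - prev‖ ^ 2

lemma iPianoLyapunov_weight_pos {L α β : ℝ} (hα : 0 < α) (hβ : 0 ≤ β)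
    (hαL : α * L < 2 * (1 - β)) : 0 < 1 / (2 * α) - L / 4 := by
  rw [sub_pos, lt_div_iff₀ (by positivity)]
  linarith

lemma objective_le_iPianoLyapunov {h : E → ℝ} {P : E → EReal} {L α β : ℝ} (hα : 0 < α)
    (hβ : 0 ≤ β) (hαL : α * L < 2 * (1 - β)) (prev cur : E) :
    h cur + (P cur).toReal ≤ iPianoLyapunov h P L α prev cur :=
  le_add_of_nonneg_right
    (mul_nonneg (iPianoLyapunov_weight_pos hα hβ hαL).le (sq_nonneg _))

lemma tendsto_objective_of_tendsto_iPianoLyapunov {h : E → ℝ} {P : E → EReal} {L α s : ℝ}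
    {ι : Type*} {l : Filter ι} {prev cur : ι → E}
    (hH : Tendsto (fun i => iPianoLyapunov h P L α (prev i) (cur i)) l (𝓝 s))
    (hstep : Tendsto (fun i => cur i - prev i) l (𝓝 0)) :
    Tendsto (fun i => h (cur i) + (P (cur i)).toReal) l (𝓝 s) := by
  simpa [iPianoLyapunov] using hH.sub ((hstep.norm.pow 2).const_mul (1 / (2 * α) - L / 4))

/-- The rate at which an iPiano step decreases the Lyapunov function, per unit of squared step
length. -/
noncomputable def iPianoDecrease (L α β : ℝ) : ℝ := (1 - β) / (2 * α) - L / 4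

lemma iPianoDecrease_pos {L α β : ℝ} (hα : 0 < α) (hαL : α * L < 2 * (1 - β)) :
    0 < iPianoDecrease L α β := by
  rw [iPianoDecrease, sub_pos, lt_div_iff₀ (by positivity)]
  linarith

variable [InnerProductSpace ℝ E] [CompleteSpace E]

/-- The vector that the first-order optimality condition of the iPiano subproblem at `cur` exhibits
as a subgradient of `P` at the minimizer `next`. -/
noncomputable def iPianoSubgradient (h : E → ℝ) (α β : ℝ) (prev cur next : E) : E :=
  -(∇ h cur - (β / α) • (cur - prev) + (1 / α) • (next - cur))

lemma iPianoDecrease_mul_le_iPianoLyapunov_sub {h : E → ℝ} {P : E → EReal} {L α β p q : ℝ}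
    (hdiff : Differentiable ℝ h) (hLip : ∀ x y, ‖∇ h x - ∇ h y‖ ≤ L * ‖x - y‖)
    (hα : 0 < α) (hβ : 0 ≤ β) {prev cur next : E} (hcur : P cur = p) (hnext : P next = q)
    (hw : HasSubgradientAt P (iPianoSubgradient h α β prev cur next) next) :
    iPianoDecrease L α β * (‖cur - prev‖ ^ 2 + ‖next - cur‖ ^ 2) ≤
      iPianoLyapunov h P L α prev cur - iPianoLyapunov h P L α cur next := by
  have hsub : q + (inner ℝ (∇ h cur) (next - cur) - β / α * inner ℝ (cur - prev) (next - cur)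
      + 1 / α * ‖next - cur‖ ^ 2) ≤ p := by
    have hcvx := hw.add_inner_le hnext hcur
    rwa [iPianoSubgradient, ← neg_sub next cur, inner_neg_neg, inner_add_left, inner_sub_left,
      real_inner_smul_left, real_inner_smul_left, real_inner_self_eq_norm_sq] at hcvx
  have hdescent := le_add_inner_gradient_add_sq_norm_of_lipschitz hdiff hLip cur next
  have hinertia : β / α * inner ℝ (cur - prev) (next - cur) ≤
      β / α * ((‖cur - prev‖ ^ 2 + ‖next - cur‖ ^ 2) / 2) := by
    gcongr
    linarith [real_inner_le_norm (cur - prev) (next - cur),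
      two_mul_le_add_sq ‖cur - prev‖ ‖next - cur‖]
  rw [iPianoDecrease, iPianoLyapunov, iPianoLyapunov, hcur, hnext, EReal.toReal_coe,
    EReal.toReal_coe]
  have hhalf : ∀ t : ℝ, t / (2 * α) = t / α / 2 := fun t => by ring
  rw [hhalf, hhalf, sub_div]
  linarith

lemma norm_gradient_add_iPianoSubgradient_sq_le {h : E → ℝ} {L α β : ℝ} (hL : 0 ≤ L)
    (hLip : ∀ x y, ‖∇ h x - ∇ h y‖ ≤ L * ‖x - y‖) (hα : 0 < α) (hβ : 0 ≤ β)
    (prev cur next : E) :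
    ‖∇ h next + iPianoSubgradient h α β prev cur next‖ ^ 2 ≤
      2 * (L + β / α + 1 / α) ^ 2 * (‖cur - prev‖ ^ 2 + ‖next - cur‖ ^ 2) := by
  have hβα : 0 ≤ β / α := by positivity
  have hα' : 0 ≤ 1 / α := by positivity
  have hnorm : ‖∇ h next + iPianoSubgradient h α β prev cur next‖ ≤
      (L + β / α + 1 / α) * (‖cur - prev‖ + ‖next - cur‖) := by
    calc ‖∇ h next + iPianoSubgradient h α β prev cur next‖
        = ‖(∇ h next - ∇ h cur) + (β / α) • (cur - prev) - (1 / α) • (next - cur)‖ := by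
          rw [iPianoSubgradient]
          congr 1
          abel
      _ ≤ ‖∇ h next - ∇ h cur‖ + ‖(β / α) • (cur - prev)‖ + ‖(1 / α) • (next - cur)‖ :=
          (norm_sub_le _ _).trans (by gcongr; exact norm_add_le _ _)
      _ ≤ L * ‖next - cur‖ + β / α * ‖cur - prev‖ + 1 / α * ‖next - cur‖ := by
          rw [norm_smul, norm_smul, Real.norm_of_nonneg hβα, Real.norm_of_nonneg hα']
          gcongr
          exact hLip next cur
      _ ≤ (L + β / α + 1 / α) * (‖cur - prev‖ + ‖next - cur‖) := by
          nlinarith [mul_nonneg hL (norm_nonneg (cur - prev)),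
            mul_nonneg hβα (norm_nonneg (next - cur)), mul_nonneg hα' (norm_nonneg (cur - prev))]
  calc ‖∇ h next + iPianoSubgradient h α β prev cur next‖ ^ 2
      ≤ ((L + β / α + 1 / α) * (‖cur - prev‖ + ‖next - cur‖)) ^ 2 := by gcongr
    _ = (L + β / α + 1 / α) ^ 2 * (‖cur - prev‖ + ‖next - cur‖) ^ 2 := mul_pow _ _ _
    _ ≤ (L + β / α + 1 / α) ^ 2 * (2 * (‖cur - prev‖ ^ 2 + ‖next - cur‖ ^ 2)) := by
        gcongr
        exact add_sq_le
    _ = 2 * (L + β / α + 1 / α) ^ 2 * (‖cur - prev‖ ^ 2 + ‖next - cur‖ ^ 2) := by ring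

end IPianoStep

namespace IsIPianoSequence

variable {n : ℕ} {h : EuclideanSpace ℝ (Fin n) → ℝ} {P : EuclideanSpace ℝ (Fin n) → EReal}
  {L α β : ℝ} {x : ℕ → EuclideanSpace ℝ (Fin n)}

lemma coe_toReal_apply_succ (hx : IsIPianoSequence h P α β x) (hP : ProperFun P) (k : ℕ) :
    ((P (x (k + 1))).toReal : EReal) = P (x (k + 1)) := by
  have hmin : ∃ prev cur, IsMinOn (iPianoObjective h P α β prev cur) univ (x (k + 1)) := by
    cases k with
    | zero => exact ⟨_, _, hx.1⟩
    | succ k => exact ⟨_, _, hx.2 k⟩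
  obtain ⟨prev, cur, hmin⟩ := hmin
  obtain ⟨z, hz⟩ := hP.2
  have hlt : iPianoObjective h P α β prev cur (x (k + 1)) < ⊤ :=
    (hmin (mem_univ z)).trans_lt (EReal.add_lt_top (EReal.coe_ne_top _) hz.ne)
  refine EReal.coe_toReal (fun htop => hlt.ne ?_) (hP.1 _)
  rw [iPianoObjective, htop, EReal.coe_add_top]

lemma hasSubgradientAt (hx : IsIPianoSequence h P α β x) (hP : ProperFun P) (hconv : ConvexFun P)
    (k : ℕ) :
    HasSubgradientAt P (iPianoSubgradient h α β (x k) (x (k + 1)) (x (k + 2))) (x (k + 2)) :=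
  hasSubgradientAt_neg_gradient_of_isLocalMin_add hconv (hx.coe_toReal_apply_succ hP (k + 1)).symm
    (hasGradientAt_inner_add_sq_norm _ _ _ α) ((hx.2 k).isLocalMin univ_mem)

lemma iPianoDecrease_mul_le_lyapunov_sub (hx : IsIPianoSequence h P α β x) (hP : ProperFun P)
    (hconv : ConvexFun P) (hdiff : Differentiable ℝ h)
    (hLip : ∀ x y, ‖∇ h x - ∇ h y‖ ≤ L * ‖x - y‖) (hα : 0 < α) (hβ : 0 ≤ β) (k : ℕ) :
    iPianoDecrease L α β * (‖x (k + 1) - x k‖ ^ 2 + ‖x (k + 2) - x (k + 1)‖ ^ 2) ≤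
      iPianoLyapunov h P L α (x k) (x (k + 1)) -
        iPianoLyapunov h P L α (x (k + 1)) (x (k + 2)) :=
  iPianoDecrease_mul_le_iPianoLyapunov_sub hdiff hLip hα hβ (hx.coe_toReal_apply_succ hP k).symm
    (hx.coe_toReal_apply_succ hP (k + 1)).symm (hx.hasSubgradientAt hP hconv k)

lemma isBounded_range (hx : IsIPianoSequence h P α β x) (hP : ProperFun P)
    (hconv : ConvexFun P) (hdiff : Differentiable ℝ h)
    (hLip : ∀ x y, ‖∇ h x - ∇ h y‖ ≤ L * ‖x - y‖) (hα : 0 < α) (hβ : 0 ≤ β)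
    (hαL : α * L < 2 * (1 - β)) (hcoercive : CoerciveFun fun x => (h x : EReal) + P x) :
    Bornology.IsBounded (range x) := by
  set H : ℕ → ℝ := fun k => iPianoLyapunov h P L α (x k) (x (k + 1))
  have hanti : Antitone H := antitone_nat_of_succ_le fun k => sub_nonneg.1 <|
    (mul_nonneg (iPianoDecrease_pos hα hαL).le (by positivity)).trans
      (hx.iPianoDecrease_mul_le_lyapunov_sub hP hconv hdiff hLip hα hβ k)
  have hsublevel : ∀ k, x (k + 1) ∈ {y | (h y : EReal) + P y ≤ H 0} := fun k => by
    rw [mem_ofPred_eq, ← hx.coe_toReal_apply_succ hP k, ← EReal.coe_add, EReal.coe_le_coe_iff]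
    exact (objective_le_iPianoLyapunov hα hβ hαL _ _).trans (hanti k.zero_le)
  refine ((hcoercive.isBounded_sublevel (H 0)).union (Bornology.isBounded_singleton (x := x 0))
    ).subset ?_
  rintro _ ⟨_ | k, rfl⟩
  · exact Or.inr rfl
  · exact Or.inl (hsublevel k)

lemma bddBelow_range_lyapunov (hx : IsIPianoSequence h P α β x) (hP : ProperFun P)
    (hconv : ConvexFun P) (hh : Continuous h) (hα : 0 < α) (hβ : 0 ≤ β)
    (hαL : α * L < 2 * (1 - β)) (hbdd : Bornology.IsBounded (range x)) :
    BddBelow (range fun k => iPianoLyapunov h P L α (x k) (x (k + 1))) := by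
  obtain ⟨m, hm⟩ := (hx.hasSubgradientAt hP hconv 0).exists_le_add_of_isBounded
    (hx.coe_toReal_apply_succ hP 1).symm hh hbdd
  refine ⟨m, ?_⟩
  rintro _ ⟨k, rfl⟩
  have hmk := hm _ (mem_range_self (k + 1))
  rw [← hx.coe_toReal_apply_succ hP k, ← EReal.coe_add, EReal.coe_le_coe_iff] at hmk
  exact hmk.trans (objective_le_iPianoLyapunov hα hβ hαL _ _)

lemma eq_and_isStationaryPoint_of_tendsto (hx : IsIPianoSequence h P α β x) (hP : ProperFun P)
    (hclosed : LowerSemicontinuous P) (hconv : ConvexFun P) (hdiff : Differentiable ℝ h)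
    (hLip : ∀ x y, ‖∇ h x - ∇ h y‖ ≤ L * ‖x - y‖) {l : Filter ℕ} [NeBot l]
    {a : EuclideanSpace ℝ (Fin n)} {s : ℝ}
    (hs : Tendsto (fun k => iPianoLyapunov h P L α (x (k + 1)) (x (k + 2))) l (𝓝 s))
    (hsq : Tendsto (fun k => ‖x (k + 1) - x k‖ ^ 2 + ‖x (k + 2) - x (k + 1)‖ ^ 2) l (𝓝 0))
    (ha : Tendsto (fun k => x (k + 2)) l (𝓝 a)) :
    (h a : EReal) + P a = s ∧ IsStationaryPoint (fun x => (h x : EReal) + P x) a := by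
  obtain ⟨hstep, hstep'⟩ := tendsto_zero_of_tendsto_sq_norm_add_sq_norm hsq
  have hgrad : Continuous (∇ h) :=
    (LipschitzWith.of_dist_le' fun y z => by simpa only [dist_eq_norm] using hLip y z).continuous
  have hvalues := tendsto_objective_of_tendsto_iPianoLyapunov hs hstep'
  have hcur : Tendsto (fun k => x (k + 1)) l (𝓝 a) := by simpa using ha.sub hstep'
  have hw : Tendsto (fun k => iPianoSubgradient h α β (x k) (x (k + 1)) (x (k + 2))) l
      (𝓝 (-∇ h a)) := by
    simpa [iPianoSubgradient] using ((((hgrad.tendsto a).comp hcur).sub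
      (hstep.const_smul (β / α))).add (hstep'.const_smul (1 / α))).neg
  have hPlim : Tendsto (fun k => (P (x (k + 2))).toReal) l (𝓝 (s - h a)) := by
    simpa using hvalues.sub ((hdiff.continuous.tendsto a).comp ha)
  obtain ⟨hval, hsub⟩ := HasSubgradientAt.of_tendsto hclosed
    (fun k => (hx.coe_toReal_apply_succ hP (k + 1)).symm) (hx.hasSubgradientAt hP hconv) ha hw hPlim
  refine ⟨by rw [hval, ← EReal.coe_add, add_sub_cancel], ?_⟩
  have hmem := hsub.add_gradient_mem_limitingSubdifferential hval (hdiff a).hasGradientAt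
  rwa [add_neg_cancel] at hmem

lemma exists_eventually_lyapunov_sub_le (hx : IsIPianoSequence h P α β x) (hP : ProperFun P)
    (hclosed : LowerSemicontinuous P) (hconv : ConvexFun P) (hdiff : Differentiable ℝ h)
    (hL : 0 ≤ L) (hLip : ∀ x y, ‖∇ h x - ∇ h y‖ ≤ L * ‖x - y‖) (hα : 0 < α) (hβ : 0 ≤ β)
    (hαL : α * L < 2 * (1 - β)) (hbdd : Bornology.IsBounded (range x))
    (hKL : ∀ a, IsStationaryPoint (fun x => (h x : EReal) + P x) a →
      HasKLExponentAt (fun x => (h x : EReal) + P x) (1 / 2) a) {s : ℝ}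
    (hs : Tendsto (fun k => iPianoLyapunov h P L α (x (k + 1)) (x (k + 2))) atTop (𝓝 s))
    (hstep : Tendsto (fun k => ‖x (k + 1) - x k‖ ^ 2 + ‖x (k + 2) - x (k + 1)‖ ^ 2)
      atTop (𝓝 0)) :
    ∃ M > 0, ∀ᶠ k in atTop, iPianoLyapunov h P L α (x (k + 1)) (x (k + 2)) - s ≤
      M * (‖x (k + 1) - x k‖ ^ 2 + ‖x (k + 2) - x (k + 1)‖ ^ 2) := by
  have hvalues := tendsto_objective_of_tendsto_iPianoLyapunov hs
    (tendsto_zero_of_tendsto_sq_norm_add_sq_norm hstep).2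
  have hbdd' : Bornology.IsBounded (range fun k => x (k + 2)) :=
    hbdd.subset (range_comp_subset_range (· + 2) x)
  have hcluster : ∀ a, MapClusterPt a atTop (fun k => x (k + 2)) →
      (h a : EReal) + P a = s ∧ HasKLExponentAt (fun x => (h x : EReal) + P x) (1 / 2) a := by
    intro a ha
    let l := comap (fun k => x (k + 2)) (𝓝 a) ⊓ atTop
    have : NeBot l := neBot_inf_comap_iff_map'.2 ha
    obtain ⟨hval, hstat⟩ := hx.eq_and_isStationaryPoint_of_tendsto hP hclosed hconv hdiff
      hLip (l := l) (hs.mono_left inf_le_right) (hstep.mono_left inf_le_right)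
      (tendsto_comap.mono_left inf_le_left)
    exact ⟨hval, hKL a hstat⟩
  obtain ⟨M, hM, hKLbound⟩ := exists_eventually_sub_le_mul_sq_norm_of_hasKLExponentAt
    (f := fun x => (h x : EReal) + P x) hbdd' hvalues
    (fun k => by rw [EReal.coe_add, hx.coe_toReal_apply_succ hP (k + 1)])
    (fun k => (hx.hasSubgradientAt hP hconv k).add_gradient_mem_limitingSubdifferential
      (hx.coe_toReal_apply_succ hP (k + 1)).symm (hdiff (x (k + 2))).hasGradientAt)
    hcluster
  have hγ : 0 < 1 / (2 * α) - L / 4 := iPianoLyapunov_weight_pos hα hβ hαL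
  refine ⟨M * (2 * (L + β / α + 1 / α) ^ 2) + (1 / (2 * α) - L / 4), by positivity, ?_⟩
  filter_upwards [hKLbound] with k hk
  have herror := mul_le_mul_of_nonneg_left (norm_gradient_add_iPianoSubgradient_sq_le hL hLip hα hβ
    (x k) (x (k + 1)) (x (k + 2))) hM
  have hinertia := mul_le_mul_of_nonneg_left
    (le_add_of_nonneg_left (a := ‖x (k + 2) - x (k + 1)‖ ^ 2)
      (sq_nonneg ‖x (k + 1) - x k‖)) hγ.le
  rw [iPianoLyapunov, add_mul, mul_assoc M]
  linarith

end IsIPianoSequence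

theorem mainTheorem12_general {n : ℕ} (h : EuclideanSpace ℝ (Fin n) → ℝ)
    (P : EuclideanSpace ℝ (Fin n) → EReal) (L α β : ℝ) (hdiff : Differentiable ℝ h)
    (hL : 0 ≤ L) (hLip : ∀ x y, ‖∇ h x - ∇ h y‖ ≤ L * ‖x - y‖) (hPproper : ProperFun P)
    (hPclosed : LowerSemicontinuous P) (hPconvex : ConvexFun P)
    (hKL : ∀ a, IsStationaryPoint (fun x => (h x : EReal) + P x) a →
      HasKLExponentAt (fun x => (h x : EReal) + P x) (1 / 2) a)
    (hβ : 0 ≤ β) (hα : 0 < α) (hαL : α * L < 2 * (1 - β))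
    (x : ℕ → EuclideanSpace ℝ (Fin n)) (hx : IsIPianoSequence h P α β x)
    (hbdd : Bornology.IsBounded (range x)) :
    ∃ a, IsStationaryPoint (fun x => (h x : EReal) + P x) a ∧ ConvergesRLinearly x a := by
  have hκ := iPianoDecrease_pos hα hαL
  have hdec := hx.iPianoDecrease_mul_le_lyapunov_sub hPproper hPconvex hdiff hLip hα hβ
  obtain ⟨s, hs, hs_le, hstep⟩ := exists_tendsto_of_sufficient_decrease hκ
    (fun k => by positivity) hdec
    (hx.bddBelow_range_lyapunov hPproper hPconvex hdiff.continuous hα hβ hαL hbdd)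
  have hs' := (tendsto_add_atTop_iff_nat 1).2 hs
  obtain ⟨M, hM, herr⟩ := hx.exists_eventually_lyapunov_sub_le hPproper hPclosed hPconvex hdiff hL
    hLip hα hβ hαL hbdd hKL hs' hstep
  obtain ⟨q, hq0, hq1, hcontract⟩ :=
    exists_eventually_succ_sub_le_mul_of_sufficient_decrease hκ hM hdec herr
  have hdec_dist : ∀ k, iPianoDecrease L α β * dist (x k) (x (k + 1)) ^ 2 ≤
      (iPianoLyapunov h P L α (x k) (x (k + 1)) - s) -
        (iPianoLyapunov h P L α (x (k + 1)) (x (k + 2)) - s) := fun k => by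
    rw [sub_sub_sub_cancel_right, dist_eq_norm']
    exact (mul_le_mul_of_nonneg_left (le_add_of_nonneg_right (sq_nonneg _)) hκ.le).trans (hdec k)
  obtain ⟨a, ha, hrate⟩ := exists_tendsto_isBigO_dist_of_sq_dist_le hκ hq0 hq1
    (fun k => sub_nonneg.2 (hs_le k)) hdec_dist hcontract
  have hstat := (hx.eq_and_isStationaryPoint_of_tendsto hPproper hPclosed hPconvex hdiff hLip hs'
    hstep ((tendsto_add_atTop_iff_nat 2).2 ha)).2
  exact ⟨a, hstat, convergesRLinearly_of_isBigO_pow (Real.sqrt_nonneg q)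
    ((Real.sqrt_lt' one_pos).2 (by simpa using hq1)) hrate⟩

theorem mainTheorem12 {n : ℕ} (h : EuclideanSpace ℝ (Fin n) → ℝ)
    (P : EuclideanSpace ℝ (Fin n) → EReal) (L α β : ℝ)
    (hdiff : Differentiable ℝ h) (hL : 0 < L)
    (hLip : ∀ x y, ‖∇ h x - ∇ h y‖ ≤ L * ‖x - y‖)
    (hPproper : ProperFun P) (hPclosed : LowerSemicontinuous P) (hPconvex : ConvexFun P)
    (hcoercive : CoerciveFun (fun x => (h x : EReal) + P x))
    (hKL : IsKLFunctionWithExponent (fun x => (h x : EReal) + P x) (1 / 2))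
    (hβ : β ∈ Ico (0 : ℝ) 1) (hα : α ∈ Ioo (0 : ℝ) (2 * (1 - β) / L))
    (x : ℕ → EuclideanSpace ℝ (Fin n)) (hx : IsIPianoSequence h P α β x) :
    ∃ a, IsStationaryPoint (fun x => (h x : EReal) + P x) a ∧ ConvergesRLinearly x a := by
  have hαL : α * L < 2 * (1 - β) := (lt_div_iff₀ hL).1 hα.2
  exact mainTheorem12_general h P L α β hdiff hL.le hLip hPproper hPclosed hPconvex
    (fun a ha => hKL a ⟨0, ha⟩) hβ.1 hα.1 hαL x hx
    (hx.isBounded_range hPproper hPconvex hdiff hLip hα.1 hβ.1 hαL hcoercive)
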